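/- Let $K$ be an algebraically closed field of characteristic zero, let $n \geq 3$ be an integer and let $\lambda \in K \setminus \{-1\}$. Then for every matrix $D \in M_n(K)$ with $\operatorname{tr}(D) = 0$ there exist matrices $A, B, C \in M_n(K)$ such that $$D = [A,B][A,C] + \lambda\,[A,C][A,B],$$ where $[X,Y] = XY - YX$ denotes the commutator. -/

import Mathlib

/-! The identity is invariant under conjugation, so `D` may be replaced by an upper triangular `T`.
With `A` the shift `N`, every upper triangular matrix of trace zero is some `[N, X]`. Choosing `[N,
B] = diag μ` turns the equation into `(μ i + lam * μ j) * S i j = T i j` for `S = [N, C]`. It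
remains to find `μ` with `∑ μ i = 0` and `∑ T i i / μ i = 0` (the two traces), and no vanishing
factor where `T i j ≠ 0`.

Splitting by generalised eigenspaces gives `T i j = 0` unless `T i i = T j j`. Hence if `μ` is
nonzero and depends only on the eigenvalue, the factors are `(1 + lam) * μ i ≠ 0`. Such `μ` exists
except when `D` is nilpotent or has exactly two eigenvalues, both nonzero; there one position of a
repeated eigenvalue gets a different weight, and `n ≥ 3` is needed. -/

/-! ### Commutators with the shift -/

/-- The nilpotent matrix with ones on the superdiagonal. -/
def upperShift (K : Type*) [Field K] (n : ℕ) : Matrix (Fin n) (Fin n) K :=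
  Matrix.of fun i j => if (i : ℕ) + 1 = j then 1 else 0

lemma upperShift_mul_apply {K : Type*} [Field K] {n : ℕ} (b : ℕ → ℕ → K) (i j : Fin n) :
    (upperShift K n * Matrix.of fun i j : Fin n => b i j) i j =
      if (i : ℕ) + 1 < n then b (i + 1) j else 0 := by
  rw [Matrix.mul_apply]
  split_ifs with h
  · rw [Finset.sum_eq_single (⟨i + 1, h⟩ : Fin n)]
    · simp [upperShift]
    · intro k _ hk
      have : (i : ℕ) + 1 ≠ k := fun h' => hk (Fin.ext h'.symm)
      simp [upperShift, this]
    · simp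
  · refine Finset.sum_eq_zero fun k _ => ?_
    have : (i : ℕ) + 1 ≠ k := by have := k.2; omega
    simp [upperShift, this]

lemma mul_upperShift_apply {K : Type*} [Field K] {n : ℕ} (b : ℕ → ℕ → K) (i j : Fin n) :
    ((Matrix.of fun i j : Fin n => b i j) * upperShift K n) i j =
      if (j : ℕ) = 0 then 0 else b i (j - 1) := by
  rw [Matrix.mul_apply]
  split_ifs with h
  · refine Finset.sum_eq_zero fun k _ => ?_
    have : (k : ℕ) + 1 ≠ j := by omega
    simp [upperShift, this]
  · have hj := j.2
    rw [Finset.sum_eq_single (⟨j - 1, by omega⟩ : Fin n)]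
    · have : (j : ℕ) - 1 + 1 = j := by omega
      simp [upperShift, this]
    · intro k _ hk
      have : (k : ℕ) + 1 ≠ j := fun h' => hk (Fin.ext (by simp; omega))
      simp [upperShift, this]
    · simp

/-- Every upper triangular matrix of trace zero is a commutator with the shift. -/
lemma exists_lie_upperShift_eq {K : Type*} [Field K] {n : ℕ} (Z : Matrix (Fin n) (Fin n) K)
    (hZ : ∀ i j, j < i → Z i j = 0) (htr : Z.trace = 0) : ∃ B, ⁅upperShift K n, B⁆ = Z := by
  let z : ℕ → ℕ → K := fun i j =>
    if h : i < n ∧ j < n then Z ⟨i, h.1⟩ ⟨j, h.2⟩ else 0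
  have hz : ∀ i j : Fin n, Z i j = z i j := fun i j => by simp [z]
  have hlow : ∀ i j, j < i → z i j = 0 := fun i j h => by
    simp only [z]
    split_ifs
    · exact hZ _ _ h
    · rfl
  have hsum : ∑ t ∈ Finset.range n, z t t = 0 := by
    rw [Finset.sum_range, ← htr, Matrix.trace]
    simp [hz]
  -- Partial sums along diagonals solve `b (i+1) j - b i (j-1) = z i j`; in the last row the only
  -- nontrivial condition is that the trace vanishes.
  let b : ℕ → ℕ → K := fun i j =>
    if i ≤ j + 1 then ∑ t ∈ Finset.range i, z t (t + (j + 1 - i)) else 0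
  refine ⟨Matrix.of fun i j : Fin n => b i j, ?_⟩
  ext i j
  rw [Ring.lie_def, Matrix.sub_apply, upperShift_mul_apply, mul_upperShift_apply, hz]
  have hi := i.2
  have hj := j.2
  generalize (i : ℕ) = i at *
  generalize (j : ℕ) = j at *
  rcases Nat.eq_zero_or_pos j with rfl | hj0
  · rw [if_pos rfl, sub_zero]
    rcases Nat.eq_zero_or_pos i with rfl | hi0
    · split_ifs with h
      · simp [b]
      · have : n = 1 := by omega
        subst this
        simpa using hsum.symm
    · rw [hlow i 0 hi0]
      simp only [b]
      rw [if_neg (show ¬ i + 1 ≤ 0 + 1 by omega), ite_self]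
  · obtain ⟨j, rfl⟩ : ∃ k, j = k + 1 := ⟨j - 1, by omega⟩
    rw [if_neg (Nat.succ_ne_zero j)]
    simp only [b, Nat.add_sub_cancel]
    by_cases hij : i ≤ j + 1
    · rw [if_pos hij, if_pos (show i + 1 ≤ j + 1 + 1 by omega),
        show j + 1 + 1 - (i + 1) = j + 1 - i by omega]
      by_cases h : i + 1 < n
      · rw [if_pos h, Finset.sum_range_succ, add_sub_cancel_left,
          show i + (j + 1 - i) = j + 1 by omega]
      · obtain rfl : i = j + 1 := by omega
        obtain rfl : n = j + 1 + 1 := by omega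
        rw [if_neg h]
        rw [Finset.sum_range_succ] at hsum
        simp only [Nat.sub_self, Nat.add_zero]
        linear_combination -hsum
    · rw [if_neg hij, if_neg (show ¬ i + 1 ≤ j + 1 + 1 by omega), ite_self, sub_zero,
        hlow i (j + 1) (by omega)]

/-- An upper triangular matrix with suitable diagonal weights is a value of the form
`⁅A, B⁆ * ⁅A, C⁆ + lam • (⁅A, C⁆ * ⁅A, B⁆)`. -/
lemma exists_lie_mul_lie_of_weights {K : Type*} [Field K] {n : ℕ} {lam : K}
    (T : Matrix (Fin n) (Fin n) K) (hT : ∀ i j, j < i → T i j = 0) (μ : Fin n → K)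
    (hμ : ∑ i, μ i = 0) (hTμ : ∑ i, T i i / μ i = 0)
    (hne : ∀ i j, i ≤ j → T i j ≠ 0 → μ i + lam * μ j ≠ 0) :
    ∃ A B C : Matrix (Fin n) (Fin n) K,
      T = ⁅A, B⁆ * ⁅A, C⁆ + lam • (⁅A, C⁆ * ⁅A, B⁆) := by
  obtain ⟨B, hB⟩ := exists_lie_upperShift_eq (Matrix.diagonal μ)
    (fun i j h => Matrix.diagonal_apply_ne _ h.ne') (by rwa [Matrix.trace_diagonal])
  -- A zero denominator occurs only where `T i j = 0`, so the quotient is then harmlessly `0`.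
  obtain ⟨C, hC⟩ := exists_lie_upperShift_eq
    (Matrix.of fun i j => T i j / (μ i + lam * μ j)) (fun i j h => by simp [hT i j h]) (by
      have : ∀ i, T i i / (μ i + lam * μ i) = (1 + lam)⁻¹ * (T i i / μ i) := fun i => by
        rw [show μ i + lam * μ i = (1 + lam) * μ i by ring, div_eq_mul_inv, mul_inv,
          div_eq_mul_inv]
        ring
      simp [Matrix.trace, this, ← Finset.mul_sum, hTμ])
  refine ⟨upperShift K n, B, C, ?_⟩
  rw [hB, hC]
  ext i j
  rw [Matrix.add_apply, Matrix.smul_apply, Matrix.diagonal_mul, Matrix.mul_diagonal,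
    Matrix.of_apply, smul_eq_mul]
  by_cases h : T i j = 0
  · simp [h]
  · have h' := hne i j (not_lt.1 fun hlt => h (hT i j hlt)) h
    field_simp

/-! ### Triangular form respecting generalised eigenspaces -/

open Module in
/-- A partial triangularising family of generalised eigenvectors. -/
lemma exists_triangular_family {K V : Type*} [Field K] [IsAlgClosed K] [AddCommGroup V]
    [Module K V] [FiniteDimensional K V] (f : End K V) (k : ℕ) (hk : k ≤ finrank K V) :
    ∃ (v : Fin k → V) (d : Fin k → K), LinearIndependent K v ∧
      (∀ i, v i ∈ f.maxGenEigenspace (d i)) ∧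
      ∀ j, f (v j) - d j • v j ∈ Submodule.span K (v '' {i | i < j}) := by
  induction k with
  | zero => exact ⟨Fin.elim0, Fin.elim0, linearIndependent_empty_type, fun i => i.elim0,
      fun i => i.elim0⟩
  | succ k ih =>
    obtain ⟨v, d, hv, hgen, htri⟩ := ih (by omega)
    set W := Submodule.span K (Set.range v) with hW
    have hWtop : W ≠ ⊤ := by
      intro h
      have := finrank_span_eq_card hv
      rw [← hW, h, finrank_top, Fintype.card_fin] at this
      omega
    obtain ⟨θ, hθ⟩ : ∃ θ, ¬ f.maxGenEigenspace θ ≤ W := by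
      by_contra! h
      apply hWtop
      rw [eq_top_iff, ← End.iSup_maxGenEigenspace_eq_top f]
      exact iSup_le h
    obtain ⟨w, hw, hwW⟩ := SetLike.not_le_iff_exists.1 hθ
    obtain ⟨w', hw', hw'W, hfw'⟩ : ∃ w' ∈ f.maxGenEigenspace θ, w' ∉ W ∧
        f w' - θ • w' ∈ W := by
      obtain ⟨p, hp⟩ := (End.mem_maxGenEigenspace f θ w).1 hw
      have hex : ∃ q, ((f - θ • (1 : End K V)) ^ q) w ∈ W := ⟨p, hp ▸ W.zero_mem⟩
      classical
      -- The last iterate of `f - θ` on `w` still outside `W` is the next basis vector.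
      obtain ⟨q, hq⟩ : ∃ q, Nat.find hex = q + 1 := by
        refine Nat.exists_eq_succ_of_ne_zero fun h0 => hwW ?_
        simpa [h0] using Nat.find_spec hex
      refine ⟨((f - θ • (1 : End K V)) ^ q) w, ?_, Nat.find_min hex (by omega), ?_⟩
      · refine (End.mem_maxGenEigenspace f θ _).2 ⟨p, ?_⟩
        rw [← Module.End.mul_apply, ← pow_add, add_comm, pow_add, Module.End.mul_apply, hp,
          map_zero]
      · have := Nat.find_spec hex
        rw [hq, pow_succ', Module.End.mul_apply] at this
        simpa using this
    refine ⟨Fin.snoc v w', Fin.snoc d θ, linearIndependent_finSnoc.2 ⟨hv, hw'W⟩, ?_, ?_⟩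
    · intro i
      refine Fin.lastCases ?_ (fun i => ?_) i
      · simpa using hw'
      · simpa using hgen i
    · intro j
      refine Fin.lastCases ?_ (fun j => ?_) j
      · simp only [Fin.snoc_last]
        refine Submodule.span_mono ?_ hfw'
        rintro _ ⟨i, rfl⟩
        exact ⟨i.castSucc, Fin.castSucc_lt_last i, by simp⟩
      · simp only [Fin.snoc_castSucc]
        refine Submodule.span_mono ?_ (htri j)
        rintro _ ⟨i, hi, rfl⟩
        exact ⟨i.castSucc, Fin.castSucc_lt_castSucc_iff.2 hi, by simp⟩

open Module in
/-- In a basis of generalised eigenvectors, an element of one generalised eigenspace only involves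
the basis vectors belonging to it. -/
lemma repr_eq_zero_of_mem_maxGenEigenspace {K V ι : Type*} [Field K] [AddCommGroup V]
    [Module K V] [Fintype ι] (f : End K V) (b : Basis ι K V) (d : ι → K)
    (hb : ∀ i, b i ∈ f.maxGenEigenspace (d i)) {θ : K} {x : V}
    (hx : x ∈ f.maxGenEigenspace θ) {i : ι} (hi : d i ≠ θ) : b.repr x i = 0 := by
  classical
  -- The part of `x` off `θ` lies both in the `θ`-space and in the sum of the others, so
  -- independence kills it.
  set y := ∑ j with d j ≠ θ, b.repr x j • b j with hy
  have hsplit : (∑ j with d j = θ, b.repr x j • b j) + y = x := by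
    rw [hy, Finset.sum_filter_add_sum_filter_not, b.sum_repr]
  have h1 : y ∈ f.maxGenEigenspace θ := by
    rw [← eq_sub_iff_add_eq'] at hsplit
    rw [hsplit]
    refine Submodule.sub_mem _ hx (Submodule.sum_mem _ fun j hj => Submodule.smul_mem _ _ ?_)
    exact (Finset.mem_filter.1 hj).2 ▸ hb j
  have h2 : y ∈ ⨆ (η) (_ : η ≠ θ), f.maxGenEigenspace η := by
    refine Submodule.sum_mem _ fun j hj => Submodule.smul_mem _ _ ?_
    exact Submodule.mem_iSup_of_mem (d j)
      (Submodule.mem_iSup_of_mem (Finset.mem_filter.1 hj).2 (hb j))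
  have h3 : y = 0 :=
    (Submodule.disjoint_def.1 (f.independent_maxGenEigenspace θ)) y h1 h2
  have h4 : b.repr y i = b.repr x i := by
    rw [hy]
    simp only [map_sum, map_smul, Basis.repr_self, Finsupp.coe_finsetSum, Finset.sum_apply,
      Finsupp.smul_apply, Finsupp.single_apply, smul_eq_mul, mul_ite, mul_one, mul_zero]
    rw [Finset.sum_ite_eq']
    simp [hi]
  rw [← h4, h3]; simp

open Module in
/-- Over an algebraically closed field, an endomorphism has an upper triangular matrix without
entries linking distinct eigenvalues. -/
lemma exists_basis_upperTriangular {K V : Type*} [Field K] [IsAlgClosed K] [AddCommGroup V]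
    [Module K V] [FiniteDimensional K V] (f : End K V) {n : ℕ} (hn : finrank K V = n) :
    ∃ b : Basis (Fin n) K V, (∀ i j, j < i → LinearMap.toMatrix b b f i j = 0) ∧
      ∀ i j, LinearMap.toMatrix b b f i j ≠ 0 →
        LinearMap.toMatrix b b f i i = LinearMap.toMatrix b b f j j := by
  obtain ⟨v, d, hv, hgen, htri⟩ := exists_triangular_family f n hn.ge
  let b := basisOfLinearIndependentOfCardEqFinrank' v hv (by simp [hn])
  have hbv : ∀ i, b i = v i := fun i => by simp [b]
  have hentry : ∀ i j, LinearMap.toMatrix b b f i j =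
      b.repr (f (v j) - d j • v j) i + if i = j then d j else 0 := by
    intro i j
    rw [LinearMap.toMatrix_apply, hbv, map_sub, map_smul, ← hbv j, b.repr_self]
    simp [Finsupp.single_apply, eq_comm]
  have hzero : ∀ i j, j ≤ i → b.repr (f (v j) - d j • v j) i = 0 := by
    intro i j hij
    have : Submodule.span K (v '' {i | i < j}) ≤ LinearMap.ker (b.coord i) := by
      rw [Submodule.span_le]
      rintro _ ⟨k, hk, rfl⟩
      have hki : k ≠ i := (lt_of_lt_of_le hk hij).ne
      simp [← hbv, hki]
    exact this (htri j)
  have hdiag : ∀ i, LinearMap.toMatrix b b f i i = d i := fun i => by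
    rw [hentry, hzero i i le_rfl]; simp
  refine ⟨b, fun i j hij => ?_, fun i j hij => ?_⟩
  · rw [hentry, hzero i j hij.le, if_neg hij.ne', add_zero]
  · rw [hdiag, hdiag]
    by_contra hne
    apply hij
    rw [LinearMap.toMatrix_apply]
    refine repr_eq_zero_of_mem_maxGenEigenspace f b d (fun k => hbv k ▸ hgen k)
      (θ := d j) ?_ hne
    rw [hbv]
    exact End.mapsTo_maxGenEigenspace_of_comm (Commute.refl f) (d j) (hgen j)

/-! ### Choice of diagonal weights -/

/-- On a nonempty finite linear order, put `y` at one end and `x` elsewhere. -/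
lemma exists_extremal_weight {K ι : Type*} [Field K] [LinearOrder ι] {lam x y : K}
    (hlam : lam ≠ -1) (hx : x ≠ 0) (hy : y ≠ 0) (hxy : x + lam * y ≠ 0 ∨ y + lam * x ≠ 0)
    (S : Finset ι) (hS : S.Nonempty) :
    ∃ e ∈ S, ∀ i ∈ S, ∀ j ∈ S, i ≤ j →
      (if i = e then y else x) + lam * (if j = e then y else x) ≠ 0 := by
  have h1 : ∀ w : K, w ≠ 0 → w + lam * w ≠ 0 := fun w hw h => by
    have : (1 + lam) * w = 0 := by linear_combination h
    rcases mul_eq_zero.1 this with h | h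
    · exact hlam (by linear_combination h)
    · exact hw h
  -- With `e` maximal only the mixed factor `x + lam * y` occurs; with `e` minimal, only `y + lam *
  -- x`.
  rcases hxy with h | h
  · refine ⟨S.max' hS, S.max'_mem hS, fun i hi j hj hij => ?_⟩
    split_ifs with h2 h3 h3
    · exact h1 y hy
    · exact absurd (le_antisymm (S.le_max' j hj) (h2 ▸ hij)) h3
    · exact h
    · exact h1 x hx
  · refine ⟨S.min' hS, S.min'_mem hS, fun i hi j hj hij => ?_⟩
    split_ifs with h2 h3 h3
    · exact h1 y hy
    · exact h
    · exact absurd (le_antisymm (h3 ▸ hij) (S.min'_le i hi)) h2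
    · exact h1 x hx

lemma exists_quadratic_root {K : Type*} [Field K] [IsAlgClosed K] [CharZero K] {a b c : K}
    (ha : a ≠ 0) : ∃ x, a * (x * x) + b * x + c = 0 := by
  refine exists_quadratic_eq_zero ha ?_
  obtain ⟨s, hs⟩ := IsAlgClosed.exists_pow_nat_eq (discrim a b c) (n := 2) (by norm_num)
  exact ⟨s, by rw [← hs, sq]⟩

/-- Weights adapted to the zero diagonal. -/
lemma exists_weights_zero {K : Type*} [Field K] [CharZero K] {n : ℕ} (hn : 3 ≤ n)
    {lam : K} (hlam : lam ≠ -1) :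
    ∃ μ : Fin n → K, ∑ i, μ i = 0 ∧ ∀ i j, i ≤ j → μ i + lam * μ j ≠ 0 := by
  have hn1 : ((n - 1 : ℕ) : K) ≠ 0 := by
    rw [Nat.cast_ne_zero]; omega
  have hc : ((n - 1 : ℕ) : K) = n - 1 := by
    rw [Nat.cast_sub (by omega)]; simp
  have hn2 : ((n - 2 : ℕ) : K) ≠ 0 := by
    rw [Nat.cast_ne_zero]; omega
  have hc2 : ((n - 2 : ℕ) : K) = n - 2 := by
    rw [Nat.cast_sub (by omega)]; simp
  have hn0 : (n : K) ≠ 0 := by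
    rw [Nat.cast_ne_zero]; omega
  rw [hc] at hn1
  rw [hc2] at hn2
  -- If both vanish, `lam = n - 1` and `n * (n - 2) = 0`, excluded by `n ≥ 3`.
  have hne : (1 : K) + lam * (1 - n) ≠ 0 ∨ (1 - n : K) + lam * 1 ≠ 0 := by
    by_contra! h
    obtain ⟨h1, h2⟩ := h
    have : (n : K) * (n - 2) = 0 := by
      linear_combination (-1 : K) * h1 + (1 - n : K) * h2
    exact mul_ne_zero hn0 hn2 this
  have : NeZero n := ⟨by omega⟩
  obtain ⟨e, -, he⟩ := exists_extremal_weight hlam one_ne_zero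
    (y := (1 - n : K)) (fun h => hn1 (by linear_combination -h)) hne
    (Finset.univ : Finset (Fin n)) Finset.univ_nonempty
  refine ⟨fun i => if i = e then 1 - n else 1, ?_, fun i j h =>
    he i (Finset.mem_univ _) j (Finset.mem_univ _) h⟩
  have : ∀ i : Fin n, (if i = e then (1 - n : K) else 1) = 1 + if i = e then -(n : K) else 0 := by
    intro i; split_ifs <;> ring
  simp [this, Finset.sum_add_distrib]

/-- Weights when some diagonal value `a` has multiplicity at least two and less than `n`. -/
lemma exists_weights_two {K : Type*} [Field K] [IsAlgClosed K] [CharZero K] {n : ℕ}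
    {lam : K} (hlam : lam ≠ -1) (d : Fin n → K) (hd : ∑ i, d i = 0) (a : K)
    (S : Finset (Fin n)) (hS : ∀ i, i ∈ S ↔ d i = a) (hm : 2 ≤ S.card) (hmn : S.card < n) :
    ∃ μ : Fin n → K, ∑ i, μ i = 0 ∧ ∑ i, d i / μ i = 0 ∧
      ∀ i j, i ≤ j → d i = d j → μ i + lam * μ j ≠ 0 := by
  classical
  set m := S.card with hmdef
  obtain ⟨k, hk⟩ : ∃ k, m = k + 2 := ⟨m - 2, by omega⟩
  obtain ⟨l, hl⟩ : ∃ l, n = m + l + 1 := ⟨n - m - 1, by omega⟩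
  have hmK : (m : K) = k + 2 := by rw [hk]; push_cast; ring
  have hnK : (n : K) = m + l + 1 := by rw [hl]; push_cast; ring
  have hk1 : (k : K) + 1 ≠ 0 := by exact_mod_cast Nat.succ_ne_zero k
  have hk2 : (k : K) + 2 ≠ 0 := by exact_mod_cast Nat.succ_ne_zero (k + 1)
  have hl1 : (l : K) + 1 ≠ 0 := by exact_mod_cast Nat.succ_ne_zero l
  -- Weights: `x` on `m - 1` positions of `a`, `y` on the remaining one, `1` elsewhere. The
  -- quadratic results from eliminating `y` between the two sum conditions.
  obtain ⟨x, hx⟩ := exists_quadratic_root (K := K) (a := m * (m - 1))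
    (b := 1 - (m - 1) ^ 2 - m * (m - n)) (c := (m - 1) * (m - n))
    (by rw [hmK]; ring_nf; ring_nf at hk1 hk2
        have := mul_ne_zero hk1 hk2
        ring_nf at this; exact this)
  have hx0 : x ≠ 0 := by
    rintro rfl
    have : ((k : K) + 1) * (l + 1) = 0 := by
      rw [hnK, hmK] at hx; linear_combination -hx
    exact mul_ne_zero hk1 hl1 this
  obtain ⟨y, hy⟩ : ∃ y : K, y = m - n - (m - 1) * x := ⟨_, rfl⟩
  have hxy : (m - 1) * y + x = m * x * y := by
    rw [hy]; linear_combination hx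
  have hy0 : y ≠ 0 := by
    rintro rfl
    exact hx0 (by linear_combination hxy)
  -- If both vanish, then `lam = 1` and `y = -x`, whence `m * (n - m) + (m - 2) ^ 2 = 0`, impossible
  -- as `m < n`.
  have hne : x + lam * y ≠ 0 ∨ y + lam * x ≠ 0 := by
    by_contra! h
    obtain ⟨h1, h2⟩ := h
    have h3 : (lam + 1) * ((lam - 1) * x) = 0 := by linear_combination lam * h2 - h1
    have h4 : lam = 1 := by
      rcases mul_eq_zero.1 h3 with h | h
      · exact absurd (by linear_combination h) hlam
      · rcases mul_eq_zero.1 h with h | h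
        · linear_combination h
        · exact absurd h hx0
    have h5 : y = -x := by rw [h4] at h1; linear_combination h1
    have h6 : (m : K) * x = m - 2 := by
      apply mul_left_cancel₀ hx0
      rw [h5] at hxy; linear_combination hxy
    have h7 : (n : K) - m + (m - 2) * x = 0 := by
      linear_combination hy - h5
    have h8 : (m : K) * (n - m) + (m - 2) ^ 2 = 0 := by
      linear_combination m * h7 - (m - 2 : K) * h6
    rw [hnK, hmK] at h8
    have h9 : (((k + 2) * (l + 1) + k ^ 2 : ℕ) : K) = 0 := by
      push_cast; linear_combination h8
    rw [Nat.cast_eq_zero] at h9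
    have : 0 < (k + 2) * (l + 1) := by positivity
    omega
  obtain ⟨e, heS, he⟩ := exists_extremal_weight hlam hx0 hy0 hne S
    (Finset.card_pos.1 (by omega))
  have hcard : (∑ i, if d i = a then (1 : K) else 0) = m := by
    rw [Finset.sum_boole, hmdef]
    congr 2; ext i; simp [hS]
  have hea : d e = a := (hS e).1 heS
  refine ⟨fun i => if d i = a then (if i = e then y else x) else 1, ?_, ?_, ?_⟩
  · have : ∀ i, (if d i = a then (if i = e then y else x) else 1) =
        1 + (x - 1) * (if d i = a then 1 else 0) + if i = e then y - x else 0 := by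
      intro i
      by_cases h : i = e
      · subst h; simp [hea]
      · simp only [h, if_false]; split_ifs <;> ring
    simp only [this, Finset.sum_add_distrib, ← Finset.mul_sum, hcard]
    simp only [Finset.sum_const, Finset.card_univ, Fintype.card_fin, nsmul_eq_mul, mul_one,
      Finset.sum_ite_eq', Finset.mem_univ, if_true]
    rw [hy]; ring
  · have : ∀ i, d i / (if d i = a then (if i = e then y else x) else 1) =
        d i + (a / x - a) * (if d i = a then 1 else 0) + if i = e then a / y - a / x else 0 := by
      intro i
      by_cases h : i = e
      · subst h; simp [hea]
      · simp only [h, if_false]; split_ifs with h2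
        · rw [h2]; ring
        · ring
    simp only [this, Finset.sum_add_distrib, ← Finset.mul_sum, hcard, hd]
    simp only [Finset.sum_ite_eq', Finset.mem_univ, if_true]
    field_simp
    linear_combination a * hxy
  · intro i j hij hdij
    by_cases h : d i = a
    · have h' : d j = a := hdij ▸ h
      simp only [h, h', if_true]
      exact he i ((hS i).2 h) j ((hS j).2 h') hij
    · have h' : d j ≠ a := hdij ▸ h
      simp only [h, h', if_false]
      intro h0; exact hlam (by linear_combination h0)

/-- Weights when two distinct nonzero diagonal values have total contribution different from
zero. -/
lemma exists_weights_pair {K : Type*} [Field K] [IsAlgClosed K] [CharZero K] [DecidableEq K] {n : ℕ}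
    (d : Fin n → K) (hd : ∑ i, d i = 0) (a b : K)
    (hab : a ≠ b) (ha : a ≠ 0) (hb : b ≠ 0) (p q : ℕ) (hp : p ≠ 0) (hq : q ≠ 0)
    (hpc : (∑ i, if d i = a then (1 : K) else 0) = p)
    (hqc : (∑ i, if d i = b then (1 : K) else 0) = q)
    (hpq : p * a + q * b ≠ 0) :
    ∃ g : K → K, (∀ t, g t ≠ 0) ∧ ∑ i, g (d i) = 0 ∧ ∑ i, d i / g (d i) = 0 := by
  have hpK : (p : K) ≠ 0 := Nat.cast_ne_zero.2 hp
  have hqK : (q : K) ≠ 0 := Nat.cast_ne_zero.2 hq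
  -- Otherwise `a` and `b` are the only values and `p * a + q * b` is the trace, zero.
  have hrest : (q : K) - n + p ≠ 0 := by
    intro h0
    apply hpq
    have h1 : (∑ i, if d i ≠ a ∧ d i ≠ b then (1 : K) else 0) = 0 := by
      have : ∀ i, (if d i ≠ a ∧ d i ≠ b then (1 : K) else 0) =
          1 - (if d i = a then (1 : K) else 0) - (if d i = b then (1 : K) else 0) := by
        intro i
        by_cases h : d i = a
        · simp [h, hab]
        · by_cases h' : d i = b
          · simp [h', hab.symm]
          · simp [h, h']
      simp only [this, Finset.sum_sub_distrib, hpc, hqc]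
      simp only [Finset.sum_const, Finset.card_univ, Fintype.card_fin, nsmul_eq_mul, mul_one]
      linear_combination -h0
    rw [Finset.sum_boole, Nat.cast_eq_zero, Finset.card_eq_zero,
      Finset.filter_eq_empty_iff] at h1
    have : ∀ i, d i = a * (if d i = a then (1 : K) else 0) + b * (if d i = b then 1 else 0) := by
      intro i
      by_cases h : d i = a
      · simp [h, hab]
      · have h' : d i = b := by
          by_contra h'; exact h1 (Finset.mem_univ i) ⟨h, h'⟩
        simp [h', hab.symm]
    rw [Finset.sum_congr rfl fun i _ => this i, Finset.sum_add_distrib, ← Finset.mul_sum,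
      ← Finset.mul_sum, hpc, hqc] at hd
    linear_combination hd
  -- Weights `u` on `a`, `v` on `b`, `1` elsewhere; `v` is eliminated by the first sum.
  obtain ⟨u, hu⟩ := exists_quadratic_root (K := K) (a := p * (p * a + q * b))
    (b := -(p * a) * (q - n + p + p) + q * b * (n - p)) (c := p * a * (q - n + p))
    (mul_ne_zero hpK hpq)
  have hu0 : u ≠ 0 := by
    rintro rfl
    exact mul_ne_zero (mul_ne_zero hpK ha) hrest (by linear_combination hu)
  obtain ⟨v, hv⟩ : ∃ v : K, v = 1 - (n + p * (u - 1)) / q := ⟨_, rfl⟩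
  have hqv : q * v = q - (n + p * (u - 1)) := by
    rw [hv]; field_simp
  have huv : p * a * (1 - u) * v + q * b * (1 - v) * u = 0 := by
    apply mul_left_cancel₀ hqK
    linear_combination hu + (p * a * (1 - u) - q * b * u) * hqv
  have hv0 : v ≠ 0 := by
    intro h
    rw [h] at huv
    exact mul_ne_zero (mul_ne_zero hqK hb) hu0 (by linear_combination huv)
  refine ⟨fun t => if t = a then u else if t = b then v else 1, ?_, ?_, ?_⟩
  · intro t
    dsimp only
    split_ifs
    exacts [hu0, hv0, one_ne_zero]
  · have : ∀ t, (if t = a then u else if t = b then v else 1) =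
        1 + (u - 1) * (if t = a then 1 else 0) + (v - 1) * (if t = b then 1 else 0) := by
      intro t
      by_cases h : t = a
      · simp [h, hab]
      · by_cases h' : t = b
        · simp [h', hab.symm]
        · simp [h, h']
    simp only [this, Finset.sum_add_distrib, ← Finset.mul_sum, hpc, hqc]
    simp only [Finset.sum_const, Finset.card_univ, Fintype.card_fin, nsmul_eq_mul, mul_one]
    linear_combination hqv
  · have : ∀ t, t / (if t = a then u else if t = b then v else 1) =
        t + (a / u - a) * (if t = a then 1 else 0) + (b / v - b) * (if t = b then 1 else 0) := by
      intro t
      by_cases h : t = a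
      · simp [h, hab]
      · by_cases h' : t = b
        · simp [h', hab.symm]
        · simp [h, h']
    simp only [this, Finset.sum_add_distrib, ← Finset.mul_sum, hpc, hqc, hd]
    field_simp
    linear_combination huv

/-- Diagonal weights solving both trace equations and avoiding the resonances with `lam`. -/
lemma exists_weights {K : Type*} [Field K] [IsAlgClosed K] [CharZero K] {n : ℕ} (hn : 3 ≤ n)
    {lam : K} (hlam : lam ≠ -1) (d : Fin n → K) (hd : ∑ i, d i = 0) :
    ∃ μ : Fin n → K, ∑ i, μ i = 0 ∧ ∑ i, d i / μ i = 0 ∧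
      ∀ i j, i ≤ j → d i = d j → μ i + lam * μ j ≠ 0 := by
  classical
  have of_fun : (∃ g : K → K, (∀ t, g t ≠ 0) ∧ ∑ i, g (d i) = 0 ∧ ∑ i, d i / g (d i) = 0) →
      ∃ μ : Fin n → K, ∑ i, μ i = 0 ∧ ∑ i, d i / μ i = 0 ∧
        ∀ i j, i ≤ j → d i = d j → μ i + lam * μ j ≠ 0 := by
    rintro ⟨g, hg, h1, h2⟩
    refine ⟨fun i => g (d i), h1, h2, fun i j _ hij h0 => ?_⟩
    dsimp only at h0
    rw [hij] at h0
    have : (1 + lam) * g (d j) = 0 := by linear_combination h0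
    rcases mul_eq_zero.1 this with h | h
    · exact hlam (by linear_combination h)
    · exact hg _ h
  let mult : K → ℕ := fun a => (Finset.univ.filter fun i => d i = a).card
  have hmult : ∀ a, (∑ i, if d i = a then (1 : K) else 0) = mult a := fun a => by
    rw [Finset.sum_boole]
  have hmult0 : ∀ i, mult (d i) ≠ 0 := fun i =>
    Finset.card_ne_zero.2 ⟨i, by simp⟩
  by_cases hpair : ∃ i j, d i ≠ d j ∧ d i ≠ 0 ∧ d j ≠ 0 ∧
      mult (d i) * d i + mult (d j) * d j ≠ 0
  · obtain ⟨i, j, hij, hi, hj, h⟩ := hpair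
    exact of_fun (exists_weights_pair d hd _ _ hij hi hj _ _ (hmult0 i) (hmult0 j)
      (hmult _) (hmult _) h)
  push Not at hpair
  by_cases hz : ∀ i, d i = 0
  · obtain ⟨μ, h1, h2⟩ := exists_weights_zero hn hlam
    exact ⟨μ, h1, by simp [hz], fun i j hij _ => h2 i j hij⟩
  push Not at hz
  obtain ⟨i, hi⟩ := hz
  have hi' : (mult (d i) : K) * d i ≠ 0 := mul_ne_zero (Nat.cast_ne_zero.2 (hmult0 i)) hi
  obtain ⟨j, hj, hji⟩ : ∃ j, d j ≠ 0 ∧ d j ≠ d i := by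
    by_contra! h
    have : ∀ k, d k = d i * (if d k = d i then (1 : K) else 0) := by
      intro k
      by_cases hk : d k = 0
      · simp [hk, hi.symm]
      · simp [h k hk]
    rw [Finset.sum_congr rfl fun k _ => this k, ← Finset.mul_sum, hmult] at hd
    exact hi' (by linear_combination hd)
  have hsum := hpair i j hji.symm hi hj
  have hvals : ∀ k, d k ≠ 0 → d k ≠ d i → d k = d j := by
    intro k hk hki
    by_contra hkj
    have h1 := hpair i k hki.symm hi hk
    have h2 := hpair j k (Ne.symm hkj) hj hk
    -- Three contributions cancelling in pairs are all zero, so exactly two nonzero values occur.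
    have : (2 : K) * (mult (d i) * d i) = 0 := by linear_combination hsum + h1 - h2
    exact mul_ne_zero two_ne_zero hi' this
  by_cases h0 : ∃ k, d k = 0
  · obtain ⟨k, hk⟩ := h0
    have hm0 : (mult 0 : K) ≠ 0 := by
      have := hmult0 k
      rw [hk] at this
      exact Nat.cast_ne_zero.2 this
    have hlt : mult 0 < n := by
      have := Finset.card_lt_card (s := Finset.univ.filter fun k => d k = 0)
        (t := Finset.univ) (Finset.filter_ssubset.2 ⟨i, Finset.mem_univ i, hi⟩)
      simpa using this
    have hne : (mult 0 : K) - n ≠ 0 := by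
      rw [sub_ne_zero]
      exact fun h => hlt.ne (Nat.cast_injective h)
    -- Zero diagonal entries absorb the first sum at no cost to the second.
    refine of_fun ⟨fun t => if t = 0 then (mult 0 - n) / mult 0 else 1, ?_, ?_, ?_⟩
    · intro t
      dsimp only
      split_ifs
      exacts [div_ne_zero hne hm0, one_ne_zero]
    · have : ∀ t : K, (if t = 0 then ((mult 0 : K) - n) / mult 0 else 1) =
          1 + (-n / mult 0) * if t = 0 then 1 else 0 := by
        intro t
        split_ifs
        · field_simp; ring
        · ring
      simp only [this, Finset.sum_add_distrib, ← Finset.mul_sum, hmult]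
      simp only [Finset.sum_const, Finset.card_univ, Fintype.card_fin, nsmul_eq_mul, mul_one]
      field_simp; ring
    · refine (Finset.sum_congr rfl fun k _ => ?_).trans hd
      by_cases h : d k = 0 <;> simp [h]
  · push Not at h0
    have htot : mult (d i) + mult (d j) = n := by
      have h1 : (Finset.univ.filter fun k => d k = d j) =
          Finset.univ.filter fun k => ¬ d k = d i := by
        ext k
        simp only [Finset.mem_filter, Finset.mem_univ, true_and]
        exact ⟨fun h => h ▸ hji, fun h => hvals k (h0 k) h⟩
      have := Finset.card_filter_add_card_filter_not (s := (Finset.univ : Finset (Fin n)))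
        (fun k => d k = d i)
      rw [← h1] at this
      simpa using this
    have hpi := hmult0 i
    have hpj := hmult0 j
    -- The multiplicities add up to `n ≥ 3`, so one is at least two.
    rcases le_or_gt 2 (mult (d i)) with h | h
    · exact exists_weights_two hlam d hd (d i) _ (by simp) h
        (show mult (d i) < n by omega)
    · exact exists_weights_two hlam d hd (d j) _ (by simp) (show 2 ≤ mult (d j) by omega)
        (show mult (d j) < n by omega)

/-! ### Transport back to `D` -/

theorem lemma4p4 {K : Type*} [Field K] [IsAlgClosed K] [CharZero K] (n : ℕ) (hn : 3 ≤ n)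
    (lam : K) (hlam : lam ≠ -1) (D : Matrix (Fin n) (Fin n) K) (hD : D.trace = 0) :
    ∃ A B C : Matrix (Fin n) (Fin n) K,
      D = ⁅A, B⁆ * ⁅A, C⁆ + lam • (⁅A, C⁆ * ⁅A, B⁆) := by
  obtain ⟨b, hupper, hlink⟩ := exists_basis_upperTriangular (Matrix.toLin' D)
    (Module.finrank_fin_fun K)
  set T := LinearMap.toMatrix b b (Matrix.toLin' D) with hT
  have htr : T.trace = 0 := by
    rw [hT, ← LinearMap.trace_eq_matrix_trace, Matrix.trace_toLin'_eq, hD]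
  obtain ⟨μ, h1, h2, h3⟩ := exists_weights hn hlam (fun i => T i i) htr
  obtain ⟨A, B, C, hABC⟩ := exists_lie_mul_lie_of_weights T hupper μ h1 h2
    fun i j hij h => h3 i j hij (hlink i j h)
  -- The change of basis as an algebra automorphism, which preserves the whole expression.
  let φ : Matrix (Fin n) (Fin n) K ≃ₐ[K] Matrix (Fin n) (Fin n) K :=
    (LinearMap.toMatrixAlgEquiv b).symm.trans LinearMap.toMatrixAlgEquiv'
  have hφ : φ T = D := by
    change LinearMap.toMatrixAlgEquiv' ((LinearMap.toMatrixAlgEquiv b).symm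
      (LinearMap.toMatrixAlgEquiv b (Matrix.toLin' D))) = D
    rw [AlgEquiv.symm_apply_apply]
    exact LinearMap.toMatrix'_toLin' D
  refine ⟨φ A, φ B, φ C, ?_⟩
  rw [← hφ, hABC]
  simp only [Ring.lie_def, map_add, map_sub, map_mul, map_smul]
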